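/- Let $R>0$ and $u>0$, and let $A=\partial B^2_R(0)\subset\mathbb R^2$ be the circle of radius $R$ about the origin. Write $\vec\alpha=(\cos\alpha,\sin\alpha)$. For $f\in C_c^\infty(\mathbb R^3)$, $\boldsymbol\mu\in A$, $p,x_3\in\mathbb R$ and $r>0$ define the toroidal and the circular Radon transform $$R_Tf(\boldsymbol\mu,p,r)=\frac1{2\pi}\int_0^{2\pi}\!\!\int_0^{2\pi} f\big(\boldsymbol\mu+(u-r\cos\beta)\vec\alpha,\;p+r\sin\beta\big)\,d\beta\,d\alpha,\qquad Mf(\boldsymbol\mu,x_3,r)=\int_0^{2\pi} f(\boldsymbol\mu+r\vec\alpha,x_3)\,d\alpha .$$ For $g$ on $A\times\mathbb R\times[0,\infty)$ with compact support put $$R_T^*g(\boldsymbol\mu,z,\rho)=\int_{\mathbb R} g\big(\boldsymbol\mu,p,\sqrt{(z-p)^2+\rho^2}\big)\,dp ,$$ and let $I_2^{-1}$ be the Fourier multiplier $\widehat{I_2^{-1}h}(\boldsymbol\mu,\boldsymbol\xi)=|\xi_2|\,\hat h(\boldsymbol\mu,\boldsymbol\xi)$, where $\hat h(\boldsymbol\mu,\boldsymbol\xi)=\int_{\mathbb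 R^2}h(\boldsymbol\mu,z,\rho)e^{-i(z\xi_1+\rho\xi_2)}\,dz\,d\rho$. Since $R_Tf$ is not compactly supported in $p$, the function $I_2^{-1}R_T^*R_Tf$ is understood as $$I_2^{-1}R_T^*R_Tf(\boldsymbol\mu,z,\rho)=\lim_{P\to\infty} I_2^{-1}R_T^*\big[\chi(p/P)\,R_Tf(\boldsymbol\mu,p,r)\big](\boldsymbol\mu,z,\rho),$$ where $\chi\in C_c^\infty(\mathbb R)$ equals $1$ near $0$. Let $f$ be a smooth compactly supported function on $\mathbb R^3$ with support in the solid cylinder $\{x_1^2+x_2^2\le R^2\}$. Then for all $\boldsymbol\mu\in A$, $z,\rho\in\mathbb R$ the limit exists and is the same for every $\chi$ (all the integrals that define the expressions under the limit converge absolutely), and for all $\boldsymbol\mu\in A$, $x_3\in\mathbb R$ and $r>0$ $$Mf(\boldsymbol\mu,x_3,r)=\begin{cases}\displaystyle\sum_{j=0}^{\lfloor R/u+1/2\rfloor}(-1)^j\, I_2^{-1}R_T^*R_Tf\big(\boldsymbol\mu,x_3,(2j+1)u-r\big)&\text{if } r\le u,\\[2ex]\displaystyle\sum_{j=0}^{\lfloor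 R/u\rfloor}(-1)^j\, I_2^{-1}R_T^*R_Tf\big(\boldsymbol\mu,x_3,(2j+1)u+r\big)&\text{if } r>u.\end{cases}$$ -/

import Mathlib

open Filter Topology MeasureTheory
open scoped ContDiff

noncomputable section

namespace Toroidal

/-- The Euclidean plane. Points of three-space are pairs `(y, x₃) : Plane × ℝ`. -/
abbrev Plane : Type := EuclideanSpace ℝ (Fin 2)

/-- The unit vector `(cos α, sin α)`. -/
def dir (α : ℝ) : Plane := !₂[Real.cos α, Real.sin α]

/-- The toroidal Radon transform `R_T f (μ, p, r)`: the torus has centre `(μ, p)`, the radius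
of its central circle is `u` and the radius of its tube is `r`. -/
def toroidalRadon (u : ℝ) (f : Plane × ℝ → ℂ) (μ : Plane) (p r : ℝ) : ℂ :=
  (1 / (2 * Real.pi) : ℂ) * ∫ α in (0 : ℝ)..(2 * Real.pi), ∫ β in (0 : ℝ)..(2 * Real.pi),
    f (μ + (u - r * Real.cos β) • dir α, p + r * Real.sin β)

/-- The circular Radon transform `M f (μ, x₃, r)`. -/
def circularRadon (f : Plane × ℝ → ℂ) (μ : Plane) (x₃ r : ℝ) : ℂ :=
  ∫ α in (0 : ℝ)..(2 * Real.pi), f (μ + r • dir α, x₃)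

/-- The operator `R_T^*` at a fixed `μ`: it maps a function `g (p, r)` to the function
`(z, ρ) ↦ ∫ g (p, √((z - p)² + ρ²)) dp` on the plane. -/
def backProj (g : ℝ → ℝ → ℂ) (x : ℝ × ℝ) : ℂ :=
  ∫ p : ℝ, g p (Real.sqrt ((x.1 - p) ^ 2 + x.2 ^ 2))

/-- The two-dimensional Fourier transform `ĥ(ξ) = ∫ h(x) e^{-i x·ξ} dx`. -/
def fourier₂ (h : ℝ × ℝ → ℂ) (ξ : ℝ × ℝ) : ℂ :=
  ∫ x : ℝ × ℝ, Complex.exp (-Complex.I * ((x.1 * ξ.1 + x.2 * ξ.2 : ℝ) : ℂ)) * h x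

/-- The inverse two-dimensional Fourier transform `(4π²)⁻¹ ∫ H(ξ) e^{i x·ξ} dξ`. -/
def invFourier₂ (H : ℝ × ℝ → ℂ) (x : ℝ × ℝ) : ℂ :=
  (1 / (4 * Real.pi ^ 2) : ℂ) *
    ∫ ξ : ℝ × ℝ, Complex.exp (Complex.I * ((x.1 * ξ.1 + x.2 * ξ.2 : ℝ) : ℂ)) * H ξ

/-- The operator `I₂⁻¹`, which multiplies the Fourier transform by `|ξ₂|`. -/
def invRiesz₂ (h : ℝ × ℝ → ℂ) : ℝ × ℝ → ℂ :=
  invFourier₂ fun ξ => ((|ξ.2| : ℝ) : ℂ) * fourier₂ h ξ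

/-- A cutoff: a smooth compactly supported function on the line, equal to `1` near `0`. -/
def IsCutoff (χ : ℝ → ℝ) : Prop :=
  ContDiff ℝ ∞ χ ∧ HasCompactSupport χ ∧ ∀ᶠ t in 𝓝 (0 : ℝ), χ t = 1

/-- The function `χ(p / P) g(p, r)`, localised in the position `p` of the centre. -/
def localize (χ : ℝ → ℝ) (P : ℝ) (g : ℝ → ℝ → ℂ) (p r : ℝ) : ℂ :=
  (χ (p / P) : ℂ) * g p r

/-- `k = I₂⁻¹ R_T^* g`, for a function `g (p, r)` that need not have compact support in `p`.
The integral `R_T^* g` itself need not converge (for `g = R_T f` it usually diverges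
logarithmically, the divergent part not depending on `ρ`), so the composite is extended from
compactly supported functions by cutting off in `p`: for every cutoff `χ`, the integrals that
define `I₂⁻¹ R_T^*` of `χ(p / P) g(p, r)` converge absolutely, and `I₂⁻¹ R_T^*` of these
functions tends to `k` at every point `(z, ρ)` as `P → ∞`. -/
def IsInvRieszBackProj (g k : ℝ → ℝ → ℂ) : Prop :=
  ∀ χ : ℝ → ℝ, IsCutoff χ →
    (∀ P : ℝ, 0 < P →
      (∀ x : ℝ × ℝ, Integrable fun p : ℝ =>
        localize χ P g p (Real.sqrt ((x.1 - p) ^ 2 + x.2 ^ 2))) ∧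
      Integrable (backProj (localize χ P g)) ∧
      Integrable fun ξ : ℝ × ℝ => ((|ξ.2| : ℝ) : ℂ) * fourier₂ (backProj (localize χ P g)) ξ) ∧
    ∀ z ρ : ℝ, Tendsto (fun P : ℝ => invRiesz₂ (backProj (localize χ P g)) (z, ρ)) atTop
      (𝓝 (k z ρ))

theorem exists_isCutoff : ∃ χ : ℝ → ℝ, IsCutoff χ := by
  let b : ContDiffBump (0 : ℝ) := default
  exact ⟨b, b.contDiff, b.hasCompactSupport, b.eventuallyEq_one⟩

/-- `I₂⁻¹ R_T^* g` is determined by `g`. -/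
theorem IsInvRieszBackProj.unique {g k k' : ℝ → ℝ → ℂ} (h : IsInvRieszBackProj g k)
    (h' : IsInvRieszBackProj g k') : k = k' := by
  obtain ⟨χ, hχ⟩ := exists_isCutoff
  funext z ρ
  exact tendsto_nhds_unique ((h χ hχ).2 z ρ) ((h' χ hχ).2 z ρ)

end Toroidal

end

/-! Fix `μ` and put `G (z, ρ) = Mf (μ, z, u + ρ)`, which is smooth and compactly supported.
Integrating over `α` first shows that `R_T f (μ, p, r)` is the mean of `G` over the circle of radius
`r` about `(p, 0)` (`toroidalRadon_sqrt`). Hence the cut-off `R_T^* R_T f` at `x` is the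
`p`-integral of `χ(p / P)` times the mean of `G` over the circle about `(p, 0)` through `x`.

A rotation by `θ` about `(p, 0)` rotates the frequency and contributes a phase linear in `p`, so the
`p`-integral produces the Fourier transform of the cutoff, evaluated at the change of the first
frequency (`fourier₂_rotBackProj`). The multiplier `|ξ₂|` is exactly the Jacobian for passing from
`θ` to the first coordinate `c` of the rotated frequency (`integral_abs_snd_mul_rot`). As `P → ∞`
the transformed cutoffs form an approximate identity of mass `2π`, forcing `c = ξ₁`; the surviving
frequencies are `(ξ₁, ξ₂)` and `(ξ₁, -ξ₂)`. Fourier inversion gives the limit `G (z, ρ) + G (z,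
-ρ)`, whatever the cutoff (`tendsto_invRiesz₂_rotBackProj`).

So `K (z, ρ) = Mf (u + ρ) + Mf (u - ρ)`. Since `Mf` is even in the radius, the alternating sum over
odd multiples of `u` telescopes; its last term vanishes because a circle centred on `A` with radius
above `2R` misses the cylinder. -/

noncomputable section

namespace Toroidal

open scoped FourierTransform SchwartzMap

/-! ### Fourier inversion and decay on the plane. -/

/-- A smooth compactly supported function on the plane `ℝ × ℝ`, as a Schwartz function on `ℂ`. -/
def toSchwartzComplex (G : ℝ × ℝ → ℂ) (hG : ContDiff ℝ ∞ G) (hGc : HasCompactSupport G) :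
    𝓢(ℂ, ℂ) :=
  HasCompactSupport.toSchwartzMap (f := G ∘ Complex.equivRealProdCLM)
    (hGc.comp_homeomorph Complex.equivRealProdCLM.toHomeomorph)
    (hG.comp Complex.equivRealProdCLM.contDiff)

theorem integral_complex_eq (f : ℝ × ℝ → ℂ) :
    ∫ w : ℂ, f (w.re, w.im) = ∫ x : ℝ × ℝ, f x :=
  Complex.volume_preserving_equiv_real_prod.integral_comp
    Complex.measurableEquivRealProd.measurableEmbedding f

/-- The passage to `ℂ` supplies the Euclidean inner product, since `ℝ × ℝ` carries the sup norm; the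
factor `(2π)⁻¹` converts between the kernels `e^{-i x·ξ}` and `e^{-2πi x·ξ}`. -/
theorem fourier₂_eq_fourier {G : ℝ × ℝ → ℂ} (hG : ContDiff ℝ ∞ G) (hGc : HasCompactSupport G)
    (ξ : ℝ × ℝ) :
    fourier₂ G ξ = 𝓕 (toSchwartzComplex G hG hGc)
      ((2 * Real.pi)⁻¹ • (⟨ξ.1, ξ.2⟩ : ℂ)) := by
  rw [fourier₂, ← integral_complex_eq, SchwartzMap.fourier_coe, Real.fourier_eq']
  congr 1
  ext w
  have : (toSchwartzComplex G hG hGc) w = G (w.re, w.im) := rfl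
  rw [this, smul_eq_mul, inner_smul_right, Complex.inner]
  congr 2
  have := Real.pi_ne_zero
  simp only [Complex.mul_re, Complex.conj_re, Complex.conj_im]
  push_cast
  have : (Real.pi : ℂ) ≠ 0 := by exact_mod_cast this
  field_simp
  ring

theorem continuous_fourier₂ {G : ℝ × ℝ → ℂ} (hG : ContDiff ℝ ∞ G) (hGc : HasCompactSupport G) :
    Continuous (fourier₂ G) := by
  have : fourier₂ G = fun ξ => 𝓕 (toSchwartzComplex G hG hGc)
      ((2 * Real.pi)⁻¹ • (Complex.equivRealProdCLM.symm ξ)) := by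
    ext ξ
    rw [fourier₂_eq_fourier hG hGc]
    congr 2
  rw [this]
  exact (SchwartzMap.continuous _).comp (by fun_prop)

/-- The exponent leaves room for the multiplier `|ξ₂|`: the product still decays like `|ξ|⁻³`, which
is integrable on the plane. -/
theorem exists_norm_fourier₂_le {G : ℝ × ℝ → ℂ} (hG : ContDiff ℝ ∞ G) (hGc : HasCompactSupport G) :
    ∃ C : ℝ, 0 ≤ C ∧ ∀ ξ : ℝ × ℝ,
    ‖fourier₂ G ξ‖ ≤ C * (1 + (ξ.1 ^ 2 + ξ.2 ^ 2)) ^ (-2 : ℝ) := by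
  set g := 𝓕 (toSchwartzComplex G hG hGc)
  obtain ⟨C₀, h₀⟩ := g.decay 0 0
  obtain ⟨C₄, h₄⟩ := g.decay 4 0
  refine ⟨2 * (C₀ + (2 * Real.pi) ^ 4 * C₄), ?_, fun ξ => ?_⟩
  · have := h₀.1; have := h₄.1; positivity
  rw [fourier₂_eq_fourier hG hGc]
  set w : ℂ := ⟨ξ.1, ξ.2⟩
  have a := h₀.2 ((2 * Real.pi)⁻¹ • w)
  have b := h₄.2 ((2 * Real.pi)⁻¹ • w)
  have hw : ‖w‖ ^ 2 = ξ.1 ^ 2 + ξ.2 ^ 2 := by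
    rw [← Complex.normSq_eq_norm_sq, Complex.normSq_mk]; ring
  rw [norm_iteratedFDeriv_zero, norm_smul] at a b
  rw [← hw, Real.rpow_neg (by positivity), ← div_eq_mul_inv, le_div_iff₀ (by positivity)]
  norm_cast
  have hp : ‖(2 * Real.pi)⁻¹‖ = (2 * Real.pi)⁻¹ := by
    rw [Real.norm_of_nonneg (by positivity)]
  rw [hp, mul_pow] at b
  have hb : ‖w‖ ^ 4 * ‖g ((2 * Real.pi)⁻¹ • w)‖ ≤ (2 * Real.pi) ^ 4 * C₄ := by
    have h := mul_le_mul_of_nonneg_left b (show 0 ≤ (2 * Real.pi) ^ 4 by positivity)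
    calc _ = (2 * Real.pi) ^ 4 * ((2 * Real.pi)⁻¹ ^ 4 * ‖w‖ ^ 4 * ‖g ((2 * Real.pi)⁻¹ • w)‖) := by
          field_simp
      _ ≤ _ := h
  have hs : (1 + ‖w‖ ^ 2) ^ 2 ≤ 2 * (1 + ‖w‖ ^ 4) := by nlinarith [sq_nonneg (1 - ‖w‖ ^ 2)]
  calc _ ≤ ‖g ((2 * Real.pi)⁻¹ • w)‖ * (2 * (1 + ‖w‖ ^ 4)) := by gcongr
    _ = 2 * (‖w‖ ^ 0 * ‖g ((2 * Real.pi)⁻¹ • w)‖ + ‖w‖ ^ 4 * ‖g ((2 * Real.pi)⁻¹ • w)‖) := by ring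
    _ ≤ _ := by
      gcongr
      simpa using a

theorem invFourier₂_fourier₂ {G : ℝ × ℝ → ℂ} (hG : ContDiff ℝ ∞ G) (hGc : HasCompactSupport G)
    (x : ℝ × ℝ) : invFourier₂ (fourier₂ G) x = G x := by
  have hinv : 𝓕⁻ (𝓕 (toSchwartzComplex G hG hGc)) ⟨x.1, x.2⟩ = G x := by
    rw [FourierTransform.fourierInv_fourier_eq]; rfl
  rw [SchwartzMap.fourierInv_coe, Real.fourierInv_eq'] at hinv
  rw [invFourier₂, ← integral_complex_eq]
  -- Rescaling the frequency by `2π` has Jacobian `(2π)²`, which cancels the prefactor of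
  -- `invFourier₂`.
  have key := Measure.integral_comp_inv_smul (volume : Measure ℂ) (fun w : ℂ =>
    Complex.exp (((2 * Real.pi * inner ℝ w (⟨x.1, x.2⟩ : ℂ) : ℝ) : ℂ) * Complex.I) •
      𝓕 (toSchwartzComplex G hG hGc) w) (2 * Real.pi)
  rw [Complex.finrank_real_complex, abs_of_nonneg (by positivity)] at key
  have hpi : (Real.pi : ℂ) ≠ 0 := by exact_mod_cast Real.pi_ne_zero
  have e : (∫ w : ℂ, Complex.exp (Complex.I * ((x.1 * w.re + x.2 * w.im : ℝ) : ℂ)) *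
      fourier₂ G (w.re, w.im)) = ((2 * Real.pi) ^ 2 : ℝ) • ∫ w : ℂ,
    Complex.exp (((2 * Real.pi * inner ℝ w (⟨x.1, x.2⟩ : ℂ) : ℝ) : ℂ) * Complex.I) •
      𝓕 (toSchwartzComplex G hG hGc) w := by
    rw [← key]
    congr 1
    ext w
    rw [fourier₂_eq_fourier hG hGc, smul_eq_mul, real_inner_smul_left, Complex.inner]
    congr 2
    simp only [Complex.mul_re, Complex.conj_re, Complex.conj_im]
    push_cast
    field_simp
    ring
  rw [e, hinv, Complex.real_smul]
  push_cast
  field_simp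
  norm_num

/-! ### Rotations and the Jacobian `|ξ₂|`. -/

/-- The rotation of the plane `ℝ × ℝ` by the angle `θ`. -/
def rot (θ : ℝ) (x : ℝ × ℝ) : ℝ × ℝ :=
  (x.1 * Real.cos θ - x.2 * Real.sin θ, x.1 * Real.sin θ + x.2 * Real.cos θ)

theorem rot_neg_rot (θ : ℝ) (x : ℝ × ℝ) : rot (-θ) (rot θ x) = x := by
  ext <;> simp only [rot, Real.cos_neg, Real.sin_neg]
  · linear_combination x.1 * Real.sin_sq_add_cos_sq θ
  · linear_combination x.2 * Real.sin_sq_add_cos_sq θ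

theorem continuous_rot : Continuous fun y : ℝ × (ℝ × ℝ) => rot y.1 y.2 := by
  unfold rot
  fun_prop

theorem sq_add_sq_rot (θ : ℝ) (x : ℝ × ℝ) :
    (rot θ x).1 ^ 2 + (rot θ x).2 ^ 2 = x.1 ^ 2 + x.2 ^ 2 := by
  simp only [rot]
  linear_combination (x.1 ^ 2 + x.2 ^ 2) * Real.sin_sq_add_cos_sq θ

theorem integral_comp_rot (θ : ℝ) (F : ℝ × ℝ → ℂ) :
    ∫ x, F (rot θ x) = ∫ x, F x := by
  rw [← integral_complex_eq, ← integral_complex_eq F]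
  refine Eq.trans ?_ ((rotation (Circle.exp θ)).measurePreserving.integral_comp
    (rotation (Circle.exp θ)).toHomeomorph.measurableEmbedding
    fun w : ℂ => F (w.re, w.im))
  congr 1
  ext w
  congr 1
  ext <;> simp [rot, rotation_apply, Circle.coe_exp, Complex.exp_ofReal_mul_I_re,
    Complex.exp_ofReal_mul_I_im] <;> ring

/-- Along the circle of radius `a = |ξ|` the first coordinate `c = a cos ψ` satisfies `|dc| = |a sin
ψ| dψ`, and `|a sin ψ|` is the absolute second coordinate. Each `c` in `(-a, a)` is attained on the
upper and on the lower half circle, hence the two terms. -/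
theorem integral_abs_snd_mul_rot (k : ℝ × ℝ → ℂ) (hk : Continuous k) (ξ : ℝ × ℝ) :
    ∫ θ in (0 : ℝ)..(2 * Real.pi), ((|(rot (-θ) ξ).2| : ℝ) : ℂ) * k (rot (-θ) ξ) =
      ∫ c in (-Real.sqrt (ξ.1 ^ 2 + ξ.2 ^ 2))..(Real.sqrt (ξ.1 ^ 2 + ξ.2 ^ 2)),
        (k (c, Real.sqrt (ξ.1 ^ 2 + ξ.2 ^ 2 - c ^ 2)) +
          k (c, -Real.sqrt (ξ.1 ^ 2 + ξ.2 ^ 2 - c ^ 2))) := by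
  set a := Real.sqrt (ξ.1 ^ 2 + ξ.2 ^ 2) with ha
  have ha0 : 0 ≤ a := Real.sqrt_nonneg _
  have ha2 : ξ.1 ^ 2 + ξ.2 ^ 2 = a ^ 2 := (Real.sq_sqrt (by positivity)).symm
  rw [ha2]
  obtain ⟨φ, h1, h2⟩ : ∃ φ, ξ.1 = a * Real.cos φ ∧ ξ.2 = a * Real.sin φ := by
    have hn : ‖(⟨ξ.1, ξ.2⟩ : ℂ)‖ = a := by
      rw [Complex.norm_eq_sqrt_sq_add_sq]
    refine ⟨Complex.arg ⟨ξ.1, ξ.2⟩, ?_, ?_⟩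
    · rw [← hn, Complex.norm_mul_cos_arg]
    · rw [← hn, Complex.norm_mul_sin_arg]
  set W : ℝ → ℂ := fun ψ => ((|a * Real.sin ψ| : ℝ) : ℂ) * k (a * Real.cos ψ, a * Real.sin ψ)
    with hW
  have hWc : Continuous W := by fun_prop
  have hWp : Function.Periodic W (2 * Real.pi) := fun ψ => by simp [hW]
  have hr : ∀ θ, rot (-θ) ξ = (a * Real.cos (φ - θ), a * Real.sin (φ - θ)) := fun θ => by
    rw [Real.cos_sub, Real.sin_sub]
    ext <;> simp only [rot, Real.cos_neg, Real.sin_neg, h1, h2] <;> ring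
  have e1 : ∫ θ in (0 : ℝ)..(2 * Real.pi), ((|(rot (-θ) ξ).2| : ℝ) : ℂ) * k (rot (-θ) ξ) =
      ∫ ψ in (-Real.pi)..Real.pi, W ψ := by
    simp_rw [hr]
    rw [intervalIntegral.integral_comp_sub_left W φ]
    have := hWp.intervalIntegral_add_eq (φ - 2 * Real.pi) (-Real.pi)
    ring_nf at this ⊢
    exact this
  -- The lower half circle is folded onto the upper one, where `cos` is monotone and `sin`
  -- nonnegative.
  have e2 : ∫ ψ in (-Real.pi)..Real.pi, W ψ = ∫ ψ in (0 : ℝ)..Real.pi, (W ψ + W (-ψ)) := by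
    rw [intervalIntegral.integral_add (hWc.intervalIntegrable _ _)
      ((show Continuous fun ψ => W (-ψ) by fun_prop).intervalIntegrable _ _),
      intervalIntegral.integral_comp_neg, neg_zero, add_comm,
      intervalIntegral.integral_add_adjacent_intervals (hWc.intervalIntegrable _ _)
        (hWc.intervalIntegrable _ _)]
  set q : ℝ → ℂ := fun c => k (c, Real.sqrt (a ^ 2 - c ^ 2)) + k (c, -Real.sqrt (a ^ 2 - c ^ 2))
  have hq : Continuous q := by fun_prop
  have e3 := intervalIntegral.integral_deriv_smul_comp (a := 0) (b := Real.pi)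
    (f := fun ψ => a * Real.cos ψ) (f' := fun ψ => a * (-Real.sin ψ)) (g := q)
    (fun ψ _ => (Real.hasDerivAt_cos ψ).const_mul a) (by fun_prop) hq
  simp only [Real.cos_zero, Real.cos_pi, mul_one, mul_neg_one] at e3
  change _ = ∫ c in (-a)..a, q c
  rw [e1, e2, intervalIntegral.integral_symm a, ← e3, ← intervalIntegral.integral_neg]
  refine intervalIntegral.integral_congr fun ψ hψ => ?_
  rw [Set.uIcc_of_le Real.pi_pos.le] at hψ
  have hs : 0 ≤ a * Real.sin ψ := mul_nonneg ha0 (Real.sin_nonneg_of_mem_Icc hψ)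
  have hsq : Real.sqrt (a ^ 2 - (a * Real.cos ψ) ^ 2) = a * Real.sin ψ := by
    rw [← Real.sqrt_sq hs]
    congr 1
    linear_combination -(a ^ 2) * Real.sin_sq_add_cos_sq ψ
  simp only [hW, q, Function.comp, hsq, Real.cos_neg, Real.sin_neg, mul_neg, abs_neg,
    abs_of_nonneg hs, Complex.real_smul]
  push_cast
  ring

/-! ### The transformed cutoffs as an approximate identity. -/

/-- The Fourier transform `∫ χ(t) e^{i t b} dt` of a function on the line. -/
def fourier₁ (χ : ℝ → ℝ) (b : ℝ) : ℂ :=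
  ∫ t : ℝ, (χ t : ℂ) * Complex.exp (Complex.I * ((t * b : ℝ) : ℂ))

theorem fourier₁_comp_div (χ : ℝ → ℝ) {P : ℝ} (hP : 0 < P) (b : ℝ) :
    fourier₁ (fun p => χ (p / P)) b = P * fourier₁ χ (P * b) := by
  have h := Measure.integral_comp_div
    (fun t => (χ t : ℂ) * Complex.exp (Complex.I * ((t * (P * b) : ℝ) : ℂ))) P
  rw [abs_of_pos hP, Complex.real_smul] at h
  rw [fourier₁, fourier₁, ← h]
  congr 1
  ext t
  congr 4
  field_simp

/-- A cutoff, as a Schwartz function. -/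
def IsCutoff.toSchwartzMap {χ : ℝ → ℝ} (hχ : IsCutoff χ) : 𝓢(ℝ, ℂ) :=
  HasCompactSupport.toSchwartzMap (f := fun t => (χ t : ℂ))
    (hχ.2.1.comp_left Complex.ofReal_zero) (Complex.ofRealCLM.contDiff.comp hχ.1)

theorem IsCutoff.fourier₁_eq {χ : ℝ → ℝ} (hχ : IsCutoff χ) (b : ℝ) :
    fourier₁ χ b = 𝓕 hχ.toSchwartzMap ((-(2 * Real.pi)⁻¹) * b) := by
  rw [fourier₁, SchwartzMap.fourier_coe, Real.fourier_eq']
  congr 1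
  ext t
  have : hχ.toSchwartzMap t = χ t := rfl
  rw [this, smul_eq_mul, mul_comm]
  congr 2
  have : (Real.pi : ℂ) ≠ 0 := by exact_mod_cast Real.pi_ne_zero
  simp
  field_simp

theorem IsCutoff.continuous_fourier₁ {χ : ℝ → ℝ} (hχ : IsCutoff χ) : Continuous (fourier₁ χ) := by
  have : fourier₁ χ = fun b => 𝓕 hχ.toSchwartzMap ((-(2 * Real.pi)⁻¹) * b) :=
    funext hχ.fourier₁_eq
  rw [this]
  exact (SchwartzMap.continuous _).comp (by fun_prop)

theorem IsCutoff.integrable_fourier₁ {χ : ℝ → ℝ} (hχ : IsCutoff χ) : Integrable (fourier₁ χ) := by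
  have : fourier₁ χ = fun b => 𝓕 hχ.toSchwartzMap ((-(2 * Real.pi)⁻¹) * b) :=
    funext hχ.fourier₁_eq
  rw [this]
  exact (SchwartzMap.integrable _).comp_mul_left' (by simp [Real.pi_ne_zero])

/-- Fourier inversion at `0`, where `χ = 1`; this is why the limit does not depend on the cutoff. -/
theorem IsCutoff.integral_fourier₁ {χ : ℝ → ℝ} (hχ : IsCutoff χ) :
    ∫ b, fourier₁ χ b = 2 * Real.pi := by
  have hinv : 𝓕⁻ (𝓕 hχ.toSchwartzMap) 0 = 1 := by
    rw [FourierTransform.fourierInv_fourier_eq]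
    change ((χ 0 : ℝ) : ℂ) = 1
    rw [hχ.2.2.self_of_nhds, Complex.ofReal_one]
  rw [SchwartzMap.fourierInv_coe, Real.fourierInv_eq'] at hinv
  simp only [inner_zero_right, mul_zero, Complex.ofReal_zero, zero_mul, Complex.exp_zero,
    one_smul] at hinv
  have h := Measure.integral_comp_mul_left (fun b => 𝓕 hχ.toSchwartzMap b) (-(2 * Real.pi)⁻¹)
  rw [hinv] at h
  simp_rw [hχ.fourier₁_eq, h, Complex.real_smul, mul_one, inv_neg, inv_inv, abs_neg]
  rw [abs_of_pos (by positivity)]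
  push_cast
  ring

theorem integral_mul_fourier₁_comp_div (χ : ℝ → ℝ) (κ : ℝ → ℂ) (x₀ : ℝ) {P : ℝ} (hP : 0 < P) :
    ∫ c, κ c * fourier₁ (fun p => χ (p / P)) (x₀ - c) =
      ∫ b, κ (x₀ - b / P) * fourier₁ χ b := by
  have h := Measure.integral_comp_div (fun b => κ (x₀ - b) * (P * fourier₁ χ (P * b))) P
  rw [← integral_sub_left_eq_self _ volume x₀]
  simp_rw [fourier₁_comp_div χ hP, sub_sub_cancel]
  rw [abs_of_pos hP, Complex.real_smul] at h
  have hP' : (P : ℂ) ≠ 0 := by exact_mod_cast hP.ne'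
  apply mul_left_cancel₀ hP'
  rw [← h, ← integral_const_mul]
  congr 1
  ext b
  rw [mul_div_cancel₀ _ hP.ne']
  ring

theorem IsCutoff.norm_integral_mul_fourier₁_le {χ : ℝ → ℝ} (hχ : IsCutoff χ) {κ : ℝ → ℂ} {C : ℝ}
    (hC : ∀ c, ‖κ c‖ ≤ C) (x₀ : ℝ) {P : ℝ} (hP : 0 < P) :
    ‖∫ c, κ c * fourier₁ (fun p => χ (p / P)) (x₀ - c)‖ ≤ C * ∫ b, ‖fourier₁ χ b‖ := by
  rw [integral_mul_fourier₁_comp_div χ κ x₀ hP, ← integral_const_mul]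
  refine norm_integral_le_of_norm_le (hχ.integrable_fourier₁.norm.const_mul C)
    (Eventually.of_forall fun b => ?_)
  rw [norm_mul]
  gcongr
  exact hC _

/-- After rescaling, `κ` is evaluated at `x₀ - b / P`, so continuity at the single point `x₀`
suffices for dominated convergence. -/
theorem IsCutoff.tendsto_integral_mul_fourier₁ {χ : ℝ → ℝ} (hχ : IsCutoff χ) {κ : ℝ → ℂ} {C : ℝ}
    (hC : ∀ c, ‖κ c‖ ≤ C) (hκ : Measurable κ) {x₀ : ℝ} (hx : ContinuousAt κ x₀) :
    Tendsto (fun P : ℝ => ∫ c, κ c * fourier₁ (fun p => χ (p / P)) (x₀ - c)) atTop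
      (𝓝 (κ x₀ * (2 * Real.pi))) := by
  rw [← hχ.integral_fourier₁, ← integral_const_mul]
  have h : Tendsto (fun P : ℝ => ∫ b, κ (x₀ - b / P) * fourier₁ χ b) atTop
      (𝓝 (∫ b, κ x₀ * fourier₁ χ b)) := by
    refine tendsto_integral_filter_of_dominated_convergence (fun b => C * ‖fourier₁ χ b‖)
      (Eventually.of_forall fun P => ?_) (Eventually.of_forall fun P =>
        Eventually.of_forall fun b => ?_) (hχ.integrable_fourier₁.norm.const_mul C)
      (Eventually.of_forall fun b => ?_)
    · exact ((hκ.comp (by fun_prop)).mul hχ.continuous_fourier₁.measurable).aestronglyMeasurable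
    · rw [norm_mul]
      gcongr
      exact hC _
    · refine Tendsto.mul_const _ (hx.tendsto.comp ?_)
      simpa using (tendsto_const_nhds (x := x₀)).sub (tendsto_const_nhds.div_atTop tendsto_id)
  refine h.congr' ?_
  filter_upwards [eventually_gt_atTop 0] with P hP
  rw [integral_mul_fourier₁_comp_div χ κ x₀ hP]

theorem IsCutoff.comp_div {χ : ℝ → ℝ} (hχ : IsCutoff χ) {P : ℝ} (hP : 0 < P) :
    IsCutoff fun p => χ (p / P) := by
  refine ⟨hχ.1.comp (contDiff_id.div_const P), ?_, ?_⟩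
  · simpa [div_eq_inv_mul] using hχ.2.1.comp_smul (inv_ne_zero hP.ne')
  · have : Tendsto (fun p : ℝ => p / P) (𝓝 0) (𝓝 0) := by
      simpa using (continuous_id.div_const P).tendsto (0 : ℝ)
    exact this.eventually hχ.2.2

/-! ### Circular means about points of the axis and their back projection. -/

/-- Lebesgue measure on the interval `(0, 2π]`. -/
abbrev angleMeasure : Measure ℝ := volume.restrict (Set.Ioc 0 (2 * Real.pi))

theorem integral_angleMeasure (f : ℝ → ℂ) :
    ∫ θ, f θ ∂angleMeasure = ∫ θ in (0 : ℝ)..(2 * Real.pi), f θ :=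
  (intervalIntegral.integral_of_le (by positivity)).symm

/-- The function `(x, (p, θ)) ↦ χ(p) G((p, 0) + rot θ (x - (p, 0)))`. -/
def rotKernel (χ : ℝ → ℝ) (G : ℝ × ℝ → ℂ) (x y : ℝ × ℝ) : ℂ :=
  (χ y.1 : ℂ) * G ((y.1, 0) + rot y.2 (x - (y.1, 0)))

theorem continuous_rotKernel {χ : ℝ → ℝ} (hχ : Continuous χ) {G : ℝ × ℝ → ℂ}
    (hG : Continuous G) :
    Continuous fun w : (ℝ × ℝ) × (ℝ × ℝ) => rotKernel χ G w.1 w.2 := by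
  unfold rotKernel
  have : Continuous fun w : (ℝ × ℝ) × (ℝ × ℝ) => rot w.2.2 (w.1 - (w.2.1, 0)) :=
    continuous_rot.comp (f := fun w : (ℝ × ℝ) × (ℝ × ℝ) => (w.2.2, w.1 - (w.2.1, 0)))
      (by fun_prop)
  fun_prop

/-- A rotation about `(p, 0)` preserves the distance to `(p, 0)`; with `p` and the rotated point
both bounded, `x` is bounded too. This domination justifies the spatial uses of Fubini. -/
theorem exists_norm_rotKernel_le {χ : ℝ → ℝ} (hχ : Continuous χ) (hχc : HasCompactSupport χ)
    {G : ℝ × ℝ → ℂ} (hG : Continuous G) (hGc : HasCompactSupport G) :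
    ∃ C A B : ℝ, 0 ≤ C ∧ ∀ x y : ℝ × ℝ, ‖rotKernel χ G x y‖ ≤
      (Metric.closedBall (0 : ℝ × ℝ) B).indicator (fun _ => C) x *
        (Metric.closedBall (0 : ℝ) A).indicator (fun _ => 1) y.1 := by
  obtain ⟨C₁, h₁⟩ := hχc.exists_bound_of_continuous hχ
  obtain ⟨C₂, h₂⟩ := hGc.exists_bound_of_continuous hG
  obtain ⟨A, hA⟩ := hχc.isCompact.isBounded.subset_closedBall 0
  obtain ⟨B, hB⟩ := hGc.isCompact.isBounded.subset_closedBall 0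
  have h₁0 : 0 ≤ C₁ := (norm_nonneg _).trans (h₁ 0)
  have h₂0 : 0 ≤ C₂ := (norm_nonneg _).trans (h₂ 0)
  -- The squared distance from `x` to `(p, 0)` is at most `(A + B)² + B² ≤ (A + 2B)²`, and `|p| ≤ A`
  -- adds one more `A`.
  refine ⟨C₁ * C₂, A, 2 * A + 2 * B, by positivity, fun x y => ?_⟩
  by_cases h : rotKernel χ G x y = 0
  · rw [h, norm_zero]
    refine mul_nonneg (Set.indicator_nonneg (fun _ _ => by positivity) _)
      (Set.indicator_nonneg (fun _ _ => zero_le_one) _)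
  have hy : y.1 ∈ Metric.closedBall (0 : ℝ) A :=
    hA (subset_tsupport _ fun h0 => h (by simp [rotKernel, h0]))
  have hx' : (y.1, 0) + rot y.2 (x - (y.1, 0)) ∈ Metric.closedBall (0 : ℝ × ℝ) B :=
    hB (subset_tsupport _ fun h0 => h (by simp [rotKernel, h0]))
  have hx : x ∈ Metric.closedBall (0 : ℝ × ℝ) (2 * A + 2 * B) := by
    have hN := sq_add_sq_rot y.2 (x - (y.1, 0))
    rw [mem_closedBall_zero_iff, Prod.norm_def, sup_le_iff, Real.norm_eq_abs, Real.norm_eq_abs,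
      abs_le, abs_le] at hx' ⊢
    rw [mem_closedBall_zero_iff, Real.norm_eq_abs, abs_le] at hy
    simp only [Prod.fst_add, Prod.snd_add, Prod.fst_sub, Prod.snd_sub, zero_add, sub_zero]
      at hx' hN
    have ha : (rot y.2 (x - (y.1, 0))).1 ^ 2 ≤ (A + B) ^ 2 := by
      apply sq_le_sq' <;> linarith [hx'.1.1, hx'.1.2]
    have hb : (rot y.2 (x - (y.1, 0))).2 ^ 2 ≤ B ^ 2 := by
      apply sq_le_sq' <;> linarith [hx'.2.1, hx'.2.2]
    have hA0 : 0 ≤ A := by linarith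
    have hB0 : 0 ≤ B := by linarith
    have h1 : |x.1 - y.1| ≤ A + 2 * B := abs_le_of_sq_le_sq (by nlinarith) (by positivity)
    have h2 : |x.2| ≤ A + 2 * B := abs_le_of_sq_le_sq (by nlinarith) (by positivity)
    rw [abs_le] at h1 h2
    refine ⟨⟨?_, ?_⟩, ?_, ?_⟩ <;> linarith
  rw [Set.indicator_of_mem hx, Set.indicator_of_mem hy, mul_one, rotKernel, norm_mul]
  gcongr
  · simpa using h₁ y.1
  · exact h₂ _

theorem integrable_rotKernel {χ : ℝ → ℝ} (hχ : Continuous χ) (hχc : HasCompactSupport χ)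
    {G : ℝ × ℝ → ℂ} (hG : Continuous G) (hGc : HasCompactSupport G) :
    Integrable (fun w : (ℝ × ℝ) × (ℝ × ℝ) => rotKernel χ G w.1 w.2)
      (volume.prod (volume.prod angleMeasure)) := by
  obtain ⟨C, A, B, -, h⟩ := exists_norm_rotKernel_le hχ hχc hG hGc
  have h1 : Integrable ((Metric.closedBall (0 : ℝ × ℝ) B).indicator fun _ => C) :=
    (integrable_indicator_iff measurableSet_closedBall).2
      (integrableOn_const (isCompact_closedBall _ _).measure_lt_top.ne)
  have h2 : Integrable ((Metric.closedBall (0 : ℝ) A).indicator fun _ => (1 : ℝ)) :=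
    (integrable_indicator_iff measurableSet_closedBall).2
      (integrableOn_const (isCompact_closedBall _ _).measure_lt_top.ne)
  exact (h1.mul_prod (h2.comp_fst angleMeasure)).mono'
    (continuous_rotKernel hχ hG).aestronglyMeasurable (Eventually.of_forall fun w => h w.1 w.2)

theorem integrable_rotKernel_right {χ : ℝ → ℝ} (hχ : Continuous χ) (hχc : HasCompactSupport χ)
    {G : ℝ × ℝ → ℂ} (hG : Continuous G) (hGc : HasCompactSupport G) (x : ℝ × ℝ) :
    Integrable (rotKernel χ G x) (volume.prod angleMeasure) := by
  obtain ⟨C, A, B, -, h⟩ := exists_norm_rotKernel_le hχ hχc hG hGc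
  have h2 : Integrable ((Metric.closedBall (0 : ℝ) A).indicator fun _ => (1 : ℝ)) :=
    (integrable_indicator_iff measurableSet_closedBall).2
      (integrableOn_const (isCompact_closedBall _ _).measure_lt_top.ne)
  exact ((h2.comp_fst angleMeasure).const_mul _).mono'
    ((continuous_rotKernel hχ hG).comp (by fun_prop : Continuous fun y : ℝ × ℝ => (x, y))
      ).aestronglyMeasurable (Eventually.of_forall fun y => h x y)

/-- The mean of `G` over the circle about `(p, 0)` through `x`. -/
def rotMean (G : ℝ × ℝ → ℂ) (p : ℝ) (x : ℝ × ℝ) : ℂ :=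
  (1 / (2 * Real.pi) : ℂ) * ∫ θ in (0 : ℝ)..(2 * Real.pi), G ((p, 0) + rot θ (x - (p, 0)))

/-- The integral of `χ(p)` times the mean of `G` over the circle about `(p, 0)` through `x`. -/
def rotBackProj (χ : ℝ → ℝ) (G : ℝ × ℝ → ℂ) (x : ℝ × ℝ) : ℂ :=
  ∫ p, (χ p : ℂ) * rotMean G p x

theorem mul_rotMean_eq (χ : ℝ → ℝ) (G : ℝ × ℝ → ℂ) (p : ℝ) (x : ℝ × ℝ) :
    (χ p : ℂ) * rotMean G p x =
      (1 / (2 * Real.pi) : ℂ) * ∫ θ, rotKernel χ G x (p, θ) ∂angleMeasure := by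
  rw [rotMean, ← integral_angleMeasure]
  simp only [rotKernel]
  rw [integral_const_mul]
  ring

theorem integrable_mul_rotMean {χ : ℝ → ℝ} (hχ : Continuous χ) (hχc : HasCompactSupport χ)
    {G : ℝ × ℝ → ℂ} (hG : Continuous G) (hGc : HasCompactSupport G) (x : ℝ × ℝ) :
    Integrable fun p => (χ p : ℂ) * rotMean G p x := by
  simp_rw [mul_rotMean_eq]
  exact (integrable_rotKernel_right hχ hχc hG hGc x).integral_prod_left.const_mul _

theorem rotBackProj_eq {χ : ℝ → ℝ} (hχ : Continuous χ) (hχc : HasCompactSupport χ)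
    {G : ℝ × ℝ → ℂ} (hG : Continuous G) (hGc : HasCompactSupport G) (x : ℝ × ℝ) :
    rotBackProj χ G x =
      (1 / (2 * Real.pi) : ℂ) * ∫ y, rotKernel χ G x y ∂(volume.prod angleMeasure) := by
  rw [rotBackProj, integral_prod _ (integrable_rotKernel_right hχ hχc hG hGc x),
    ← integral_const_mul]
  simp_rw [mul_rotMean_eq]

theorem integrable_rotBackProj {χ : ℝ → ℝ} (hχ : Continuous χ) (hχc : HasCompactSupport χ)
    {G : ℝ × ℝ → ℂ} (hG : Continuous G) (hGc : HasCompactSupport G) :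
    Integrable (rotBackProj χ G) := by
  rw [funext (rotBackProj_eq hχ hχc hG hGc)]
  exact (integrable_rotKernel hχ hχc hG hGc).integral_prod_left.const_mul _

/-- Rotation about `(p, 0)` is rotation about the origin followed by translation by `(p, 0) - rot θ
(p, 0)`; the translation gives the phase. -/
theorem fourier₂_comp_rot_sub (G : ℝ × ℝ → ℂ) (p θ : ℝ) (ζ : ℝ × ℝ) :
    fourier₂ (fun x => G ((p, 0) + rot θ (x - (p, 0)))) ζ =
      Complex.exp (Complex.I * ((p * ((rot θ ζ).1 - ζ.1) : ℝ) : ℂ)) * fourier₂ G (rot θ ζ) := by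
  have hdot : ∀ x : ℝ × ℝ, x.1 * ζ.1 + x.2 * ζ.2 =
      (rot θ x).1 * (rot θ ζ).1 + (rot θ x).2 * (rot θ ζ).2 := fun x => by
    simp only [rot]
    linear_combination -(x.1 * ζ.1 + x.2 * ζ.2) * Real.sin_sq_add_cos_sq θ
  have hshift : ∀ x : ℝ × ℝ, (p, 0) + rot θ (x - (p, 0)) = rot θ x + ((p, 0) - rot θ (p, 0)) :=
    fun x => by
      ext <;> simp [rot] <;> ring
  simp_rw [fourier₂, hdot, hshift]
  rw [integral_comp_rot θ fun y => Complex.exp (-Complex.I *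
    ((y.1 * (rot θ ζ).1 + y.2 * (rot θ ζ).2 : ℝ) : ℂ)) * G (y + ((p, 0) - rot θ (p, 0))),
    ← integral_sub_right_eq_self _ ((p, 0) - rot θ (p, 0)), ← integral_const_mul]
  congr 1
  ext y
  rw [sub_add_cancel, ← mul_assoc, ← Complex.exp_add]
  congr 2
  have h := hdot (p, 0)
  simp only [zero_mul, add_zero] at h
  rw [mul_sub, h]
  simp only [Prod.fst_sub, Prod.snd_sub]
  push_cast
  ring

theorem fourier₂_rotBackProj {χ : ℝ → ℝ} (hχ : Continuous χ) (hχc : HasCompactSupport χ)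
    {G : ℝ × ℝ → ℂ} (hG : Continuous G) (hGc : HasCompactSupport G) (ζ : ℝ × ℝ) :
    fourier₂ (rotBackProj χ G) ζ = (1 / (2 * Real.pi) : ℂ) *
      ∫ θ, fourier₂ G (rot θ ζ) * fourier₁ χ ((rot θ ζ).1 - ζ.1) ∂angleMeasure := by
  have hint : Integrable (fun w : (ℝ × ℝ) × (ℝ × ℝ) =>
      Complex.exp (-Complex.I * ((w.1.1 * ζ.1 + w.1.2 * ζ.2 : ℝ) : ℂ)) * rotKernel χ G w.1 w.2)
      (volume.prod (volume.prod angleMeasure)) := by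
    refine (integrable_rotKernel hχ hχc hG hGc).bdd_mul (c := 1)
      (Continuous.aestronglyMeasurable (by fun_prop)) (Eventually.of_forall fun w => ?_)
    rw [neg_mul, mul_comm, ← neg_mul, ← Complex.ofReal_neg, Complex.norm_exp_ofReal_mul_I]
  have hin : ∀ y : ℝ × ℝ, ∫ x : ℝ × ℝ,
      Complex.exp (-Complex.I * ((x.1 * ζ.1 + x.2 * ζ.2 : ℝ) : ℂ)) * rotKernel χ G x y =
      fourier₂ G (rot y.2 ζ) * ((χ y.1 : ℂ) *
        Complex.exp (Complex.I * ((y.1 * ((rot y.2 ζ).1 - ζ.1) : ℝ) : ℂ))) := fun y => by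
    have h := fourier₂_comp_rot_sub G y.1 y.2 ζ
    rw [fourier₂] at h
    simp only [rotKernel]
    rw [mul_left_comm, mul_comm (fourier₂ _ _), ← h, ← integral_const_mul]
    simp_rw [mul_left_comm]
  have hint' := hint.integral_prod_right
  simp only [hin] at hint'
  rw [fourier₂]
  simp_rw [rotBackProj_eq hχ hχc hG hGc, mul_left_comm _ (1 / (2 * Real.pi) : ℂ)]
  rw [integral_const_mul]
  congr 1
  simp_rw [← integral_const_mul]
  rw [integral_integral_swap hint]
  simp_rw [hin]
  rw [integral_prod_symm _ hint']
  simp_rw [integral_const_mul, fourier₁]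

/-! ### Absolute convergence on the frequency side. -/

theorem integrable_rpow_neg_one_add_sq {r : ℝ} (hr : 2 < r) :
    Integrable fun ξ : ℝ × ℝ => (1 + (ξ.1 ^ 2 + ξ.2 ^ 2)) ^ (-r / 2) := by
  refine (integrable_rpow_neg_one_add_norm_sq (E := ℝ × ℝ) (μ := volume) (r := r)
    (by simpa using hr)).mono' (Measurable.aestronglyMeasurable (by fun_prop))
    (Eventually.of_forall fun ξ => ?_)
  rw [Real.norm_of_nonneg (by positivity)]
  refine Real.rpow_le_rpow_of_nonpos (by positivity) ?_ (by linarith)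
  rcases le_total ‖ξ.1‖ ‖ξ.2‖ with h | h
  · rw [Prod.norm_def, sup_of_le_right h, Real.norm_eq_abs, sq_abs]
    nlinarith [sq_nonneg ξ.1]
  · rw [Prod.norm_def, sup_of_le_left h, Real.norm_eq_abs, sq_abs]
    nlinarith [sq_nonneg ξ.2]

theorem integrable_fourier₂ {G : ℝ × ℝ → ℂ} (hG : ContDiff ℝ ∞ G) (hGc : HasCompactSupport G) :
    Integrable (fourier₂ G) := by
  obtain ⟨C, -, hC⟩ := exists_norm_fourier₂_le hG hGc
  refine ((integrable_rpow_neg_one_add_sq (r := 4) (by norm_num)).const_mul C).mono'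
    (continuous_fourier₂ hG hGc).aestronglyMeasurable (Eventually.of_forall fun ξ => ?_)
  have := hC ξ
  norm_num at this ⊢
  exact this

theorem norm_fourier₁_le (χ : ℝ → ℝ) (b : ℝ) : ‖fourier₁ χ b‖ ≤ ∫ t, |χ t| := by
  refine (norm_integral_le_integral_norm _).trans_eq ?_
  congr 1
  ext t
  rw [norm_mul, mul_comm Complex.I, Complex.norm_exp_ofReal_mul_I, mul_one, Complex.norm_real,
    Real.norm_eq_abs]

theorem norm_exp_I_mul_ofReal (t : ℝ) : ‖Complex.exp (Complex.I * (t : ℂ))‖ = 1 := by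
  rw [mul_comm, Complex.norm_exp_ofReal_mul_I]

theorem norm_abs_snd_mul_le {C D : ℝ} (hC : 0 ≤ C) {ζ : ℝ × ℝ} {a b : ℂ}
    (ha : ‖a‖ ≤ C * (1 + (ζ.1 ^ 2 + ζ.2 ^ 2)) ^ (-2 : ℝ)) (hb : ‖b‖ ≤ D) {s : ℝ}
    (hs : s ^ 2 ≤ ζ.1 ^ 2 + ζ.2 ^ 2) :
    ‖((|s| : ℝ) : ℂ) * (a * b)‖ ≤ C * D * (1 + (ζ.1 ^ 2 + ζ.2 ^ 2)) ^ (-(3 : ℝ) / 2) := by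
  set N := ζ.1 ^ 2 + ζ.2 ^ 2
  have hN : 0 ≤ N := by positivity
  have h1 : |s| ≤ (1 + N) ^ (1 / 2 : ℝ) := by
    rw [← Real.sqrt_eq_rpow]
    exact Real.abs_le_sqrt (by linarith)
  rw [norm_mul, norm_mul, Complex.norm_real, Real.norm_eq_abs, abs_abs]
  calc |s| * (‖a‖ * ‖b‖) ≤ (1 + N) ^ (1 / 2 : ℝ) * (C * (1 + N) ^ (-2 : ℝ) * D) := by gcongr
    _ = C * D * ((1 + N) ^ (1 / 2 : ℝ) * (1 + N) ^ (-2 : ℝ)) := by ring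
    _ = _ := by
      rw [← Real.rpow_add (by positivity)]
      norm_num

theorem integrable_abs_snd_mul_fourier₂ {χ : ℝ → ℝ} (hχ : IsCutoff χ) {G : ℝ × ℝ → ℂ}
    (hG : ContDiff ℝ ∞ G) (hGc : HasCompactSupport G) :
    Integrable (fun w : (ℝ × ℝ) × ℝ => ((|w.1.2| : ℝ) : ℂ) *
      (fourier₂ G (rot w.2 w.1) * fourier₁ χ ((rot w.2 w.1).1 - w.1.1)))
      (volume.prod angleMeasure) := by
  obtain ⟨C, hC0, hC⟩ := exists_norm_fourier₂_le hG hGc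
  have hr : Continuous fun w : (ℝ × ℝ) × ℝ => rot w.2 w.1 :=
    continuous_rot.comp (continuous_snd.prodMk continuous_fst)
  have h1 := continuous_fourier₂ hG hGc
  have h2 := hχ.continuous_fourier₁
  refine (((integrable_rpow_neg_one_add_sq (r := 3) (by norm_num)).const_mul
    (C * ∫ t, |χ t|)).comp_fst angleMeasure).mono'
    (Continuous.aestronglyMeasurable (by fun_prop)) (Eventually.of_forall fun w => ?_)
  refine norm_abs_snd_mul_le hC0 ?_ (norm_fourier₁_le χ _) (by nlinarith [sq_nonneg w.1.1])
  rw [← sq_add_sq_rot w.2 w.1]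
  exact hC _

/-- The counterpart of `integrable_abs_snd_mul_fourier₂` after the change of variable `ξ = rot θ ζ`;
it licenses taking the `θ`-integral inside. -/
theorem integrable_abs_snd_rot_mul_fourier₂ {χ : ℝ → ℝ} (hχ : IsCutoff χ) {G : ℝ × ℝ → ℂ}
    (hG : ContDiff ℝ ∞ G) (hGc : HasCompactSupport G) (x : ℝ × ℝ) :
    Integrable (fun w : (ℝ × ℝ) × ℝ => ((|(rot (-w.2) w.1).2| : ℝ) : ℂ) *
      (fourier₂ G w.1 * (Complex.exp (Complex.I *
        ((x.1 * (rot (-w.2) w.1).1 + x.2 * (rot (-w.2) w.1).2 : ℝ) : ℂ)) *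
          fourier₁ χ (w.1.1 - (rot (-w.2) w.1).1))))
      (volume.prod angleMeasure) := by
  obtain ⟨C, hC0, hC⟩ := exists_norm_fourier₂_le hG hGc
  have hr : Continuous fun w : (ℝ × ℝ) × ℝ => rot (-w.2) w.1 :=
    continuous_rot.comp (continuous_snd.neg.prodMk continuous_fst)
  have h1 := continuous_fourier₂ hG hGc
  have h2 := hχ.continuous_fourier₁
  refine (((integrable_rpow_neg_one_add_sq (r := 3) (by norm_num)).const_mul
    (C * ∫ t, |χ t|)).comp_fst angleMeasure).mono'
    (Continuous.aestronglyMeasurable (by fun_prop)) (Eventually.of_forall fun w => ?_)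
  refine norm_abs_snd_mul_le hC0 (hC _) ?_ ?_
  · rw [norm_mul, norm_exp_I_mul_ofReal, one_mul]
    exact norm_fourier₁_le χ _
  · rw [← sq_add_sq_rot (-w.2) w.1]
    nlinarith [sq_nonneg (rot (-w.2) w.1).1]

theorem integrable_abs_snd_mul_fourier₂_rotBackProj {χ : ℝ → ℝ} (hχ : IsCutoff χ)
    {G : ℝ × ℝ → ℂ} (hG : ContDiff ℝ ∞ G) (hGc : HasCompactSupport G) :
    Integrable fun ξ : ℝ × ℝ => ((|ξ.2| : ℝ) : ℂ) * fourier₂ (rotBackProj χ G) ξ := by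
  simp_rw [fourier₂_rotBackProj hχ.1.continuous hχ.2.1 hG.continuous hGc,
    mul_left_comm _ (1 / (2 * Real.pi) : ℂ), ← integral_const_mul]
  simp_rw [integral_const_mul (1 / (2 * Real.pi) : ℂ)]
  exact (integrable_abs_snd_mul_fourier₂ hχ hG hGc).integral_prod_left.const_mul _

/-- Substituting `ξ = rot θ ζ` for each `θ` frees `fourier₂ G` of the angle, so the multiplier and
the cutoff are confined to the inner integral. The constant is `4π²` from inversion times `2π` from
the mean. -/
theorem invRiesz₂_rotBackProj {χ : ℝ → ℝ} (hχ : IsCutoff χ) {G : ℝ × ℝ → ℂ}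
    (hG : ContDiff ℝ ∞ G) (hGc : HasCompactSupport G) (x : ℝ × ℝ) :
    invRiesz₂ (rotBackProj χ G) x = (1 / (8 * Real.pi ^ 3) : ℂ) * ∫ ξ, fourier₂ G ξ *
      ∫ θ in (0 : ℝ)..(2 * Real.pi), ((|(rot (-θ) ξ).2| : ℝ) : ℂ) *
        (Complex.exp (Complex.I * ((x.1 * (rot (-θ) ξ).1 + x.2 * (rot (-θ) ξ).2 : ℝ) : ℂ)) *
          fourier₁ χ (ξ.1 - (rot (-θ) ξ).1)) := by
  have hint : Integrable (fun w : (ℝ × ℝ) × ℝ =>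
      Complex.exp (Complex.I * ((x.1 * w.1.1 + x.2 * w.1.2 : ℝ) : ℂ)) * (((|w.1.2| : ℝ) : ℂ) *
      (fourier₂ G (rot w.2 w.1) * fourier₁ χ ((rot w.2 w.1).1 - w.1.1))))
      (volume.prod angleMeasure) :=
    (integrable_abs_snd_mul_fourier₂ hχ hG hGc).bdd_mul (c := 1)
      (Continuous.aestronglyMeasurable (by fun_prop))
      (Eventually.of_forall fun w => (norm_exp_I_mul_ofReal _).le)
  have hrot : ∀ θ : ℝ, ∫ ζ : ℝ × ℝ, Complex.exp (Complex.I *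
      ((x.1 * ζ.1 + x.2 * ζ.2 : ℝ) : ℂ)) * (((|ζ.2| : ℝ) : ℂ) *
      (fourier₂ G (rot θ ζ) * fourier₁ χ ((rot θ ζ).1 - ζ.1))) =
      ∫ ξ : ℝ × ℝ, ((|(rot (-θ) ξ).2| : ℝ) : ℂ) *
      (fourier₂ G ξ * (Complex.exp (Complex.I *
        ((x.1 * (rot (-θ) ξ).1 + x.2 * (rot (-θ) ξ).2 : ℝ) : ℂ)) *
          fourier₁ χ (ξ.1 - (rot (-θ) ξ).1))) := fun θ => by
    rw [← integral_comp_rot θ fun ξ : ℝ × ℝ => ((|(rot (-θ) ξ).2| : ℝ) : ℂ) *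
      (fourier₂ G ξ * (Complex.exp (Complex.I *
        ((x.1 * (rot (-θ) ξ).1 + x.2 * (rot (-θ) ξ).2 : ℝ) : ℂ)) *
          fourier₁ χ (ξ.1 - (rot (-θ) ξ).1)))]
    simp_rw [rot_neg_rot]
    congr 1
    ext ζ
    ring
  rw [invRiesz₂, invFourier₂]
  simp_rw [fourier₂_rotBackProj hχ.1.continuous hχ.2.1 hG.continuous hGc,
    mul_left_comm _ (1 / (2 * Real.pi) : ℂ)]
  rw [integral_const_mul, ← mul_assoc]
  congr 1
  · have : (Real.pi : ℂ) ≠ 0 := by exact_mod_cast Real.pi_ne_zero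
    field_simp
    norm_num
  simp_rw [← integral_const_mul]
  rw [integral_integral_swap hint]
  simp_rw [hrot]
  rw [← integral_integral_swap (integrable_abs_snd_rot_mul_fourier₂ hχ hG hGc x)]
  simp_rw [← integral_angleMeasure, ← integral_const_mul]
  simp_rw [mul_left_comm (fourier₂ G _)]

/-! ### The limit as the cutoff is removed. -/

/-- The sum of the two plane waves that share the frequency norm `a` and the first frequency
`c`, for `|c| ≤ a`. -/
def wavePair (x : ℝ × ℝ) (N c : ℝ) : ℂ :=
  (Set.Ioc (-Real.sqrt N) (Real.sqrt N)).indicator (fun c =>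
    Complex.exp (Complex.I * ((x.1 * c + x.2 * Real.sqrt (N - c ^ 2) : ℝ) : ℂ)) +
      Complex.exp (Complex.I * ((x.1 * c + x.2 * -Real.sqrt (N - c ^ 2) : ℝ) : ℂ))) c

theorem norm_wavePair_le (x : ℝ × ℝ) (N c : ℝ) : ‖wavePair x N c‖ ≤ 2 := by
  refine (norm_indicator_le_norm_self _ _).trans ((norm_add_le _ _).trans_eq ?_)
  rw [norm_exp_I_mul_ofReal, norm_exp_I_mul_ofReal]
  norm_num

theorem measurable_wavePair (x : ℝ × ℝ) (N : ℝ) : Measurable (wavePair x N) :=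
  Measurable.indicator (Continuous.measurable (by fun_prop)) measurableSet_Ioc

theorem integral_abs_snd_mul_exp_mul_fourier₁ {χ : ℝ → ℝ} (hχ : IsCutoff χ) (x ξ : ℝ × ℝ) :
    ∫ θ in (0 : ℝ)..(2 * Real.pi), ((|(rot (-θ) ξ).2| : ℝ) : ℂ) *
        (Complex.exp (Complex.I * ((x.1 * (rot (-θ) ξ).1 + x.2 * (rot (-θ) ξ).2 : ℝ) : ℂ)) *
          fourier₁ χ (ξ.1 - (rot (-θ) ξ).1)) =
      ∫ c, wavePair x (ξ.1 ^ 2 + ξ.2 ^ 2) c * fourier₁ χ (ξ.1 - c) := by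
  have h2 := hχ.continuous_fourier₁
  rw [integral_abs_snd_mul_rot (fun ζ : ℝ × ℝ => Complex.exp (Complex.I *
    ((x.1 * ζ.1 + x.2 * ζ.2 : ℝ) : ℂ)) * fourier₁ χ (ξ.1 - ζ.1)) (by fun_prop) ξ,
    intervalIntegral.integral_of_le (by linarith [Real.sqrt_nonneg (ξ.1 ^ 2 + ξ.2 ^ 2)]),
    ← integral_indicator measurableSet_Ioc]
  congr 1
  ext c
  rw [wavePair]
  by_cases hc : c ∈ Set.Ioc (-Real.sqrt (ξ.1 ^ 2 + ξ.2 ^ 2)) (Real.sqrt (ξ.1 ^ 2 + ξ.2 ^ 2))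
  · rw [Set.indicator_of_mem hc, Set.indicator_of_mem hc, add_mul]
  · rw [Set.indicator_of_notMem hc, Set.indicator_of_notMem hc, zero_mul]

theorem mem_Ioo_neg_sqrt_sqrt {ξ : ℝ × ℝ} (hξ : ξ.2 ≠ 0) :
    ξ.1 ∈ Set.Ioo (-Real.sqrt (ξ.1 ^ 2 + ξ.2 ^ 2)) (Real.sqrt (ξ.1 ^ 2 + ξ.2 ^ 2)) := by
  rw [Set.mem_Ioo, ← abs_lt]
  refine Real.lt_sqrt_of_sq_lt ?_
  rw [sq_abs]
  have : 0 < ξ.2 ^ 2 := by positivity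
  linarith

/-- Off the line `ξ₂ = 0` the point `ξ₁` is interior to the interval `|c| ≤ |ξ|`, so the jump of the
indicator is avoided. -/
theorem continuousAt_wavePair (x : ℝ × ℝ) {ξ : ℝ × ℝ} (hξ : ξ.2 ≠ 0) :
    ContinuousAt (wavePair x (ξ.1 ^ 2 + ξ.2 ^ 2)) ξ.1 := by
  refine ContinuousAt.congr (Continuous.continuousAt (by fun_prop))
    (Filter.EventuallyEq.symm ?_) (f := fun c =>
    Complex.exp (Complex.I * ((x.1 * c + x.2 * Real.sqrt (ξ.1 ^ 2 + ξ.2 ^ 2 - c ^ 2) : ℝ) : ℂ)) +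
      Complex.exp (Complex.I * ((x.1 * c + x.2 * -Real.sqrt (ξ.1 ^ 2 + ξ.2 ^ 2 - c ^ 2) : ℝ) : ℂ)))
  filter_upwards [Ioo_mem_nhds (mem_Ioo_neg_sqrt_sqrt hξ).1 (mem_Ioo_neg_sqrt_sqrt hξ).2] with c hc
  exact Set.indicator_of_mem (Set.Ioo_subset_Ioc_self hc) _

theorem wavePair_eq (x : ℝ × ℝ) {ξ : ℝ × ℝ} (hξ : ξ.2 ≠ 0) :
    wavePair x (ξ.1 ^ 2 + ξ.2 ^ 2) ξ.1 =
      Complex.exp (Complex.I * ((x.1 * ξ.1 + x.2 * ξ.2 : ℝ) : ℂ)) +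
        Complex.exp (Complex.I * ((x.1 * ξ.1 + -x.2 * ξ.2 : ℝ) : ℂ)) := by
  rw [wavePair, Set.indicator_of_mem (Set.Ioo_subset_Ioc_self (mem_Ioo_neg_sqrt_sqrt hξ)),
    add_sub_cancel_left, Real.sqrt_sq_eq_abs]
  rcases abs_choice ξ.2 with h | h <;> rw [h]
  · rw [neg_mul, mul_neg]
  · rw [neg_neg, add_comm, neg_mul, mul_neg]

theorem tendsto_invRiesz₂_rotBackProj {χ : ℝ → ℝ} (hχ : IsCutoff χ) {G : ℝ × ℝ → ℂ}
    (hG : ContDiff ℝ ∞ G) (hGc : HasCompactSupport G) (z ρ : ℝ) :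
    Tendsto (fun P : ℝ => invRiesz₂ (rotBackProj (fun p => χ (p / P)) G) (z, ρ)) atTop
      (𝓝 (G (z, ρ) + G (z, -ρ))) := by
  have hGi := integrable_fourier₂ hG hGc
  set x : ℝ × ℝ := (z, ρ) with hx
  set L : ℝ × ℝ → ℂ := fun ξ => fourier₂ G ξ *
    ((Complex.exp (Complex.I * ((x.1 * ξ.1 + x.2 * ξ.2 : ℝ) : ℂ)) +
        Complex.exp (Complex.I * ((x.1 * ξ.1 + -x.2 * ξ.2 : ℝ) : ℂ))) * (2 * Real.pi)) with hL
  have hval : (1 / (8 * Real.pi ^ 3) : ℂ) * ∫ ξ, L ξ = G (z, ρ) + G (z, -ρ) := by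
    rw [← invFourier₂_fourier₂ hG hGc (z, ρ), ← invFourier₂_fourier₂ hG hGc (z, -ρ),
      invFourier₂, invFourier₂, ← mul_add, ← integral_add, ← integral_const_mul,
      ← integral_const_mul]
    · congr 1
      ext ξ
      have : (Real.pi : ℂ) ≠ 0 := by exact_mod_cast Real.pi_ne_zero
      simp only [hL, hx]
      field_simp
      ring
    all_goals
      exact hGi.bdd_mul (c := 1) (Continuous.aestronglyMeasurable (by fun_prop))
        (Eventually.of_forall fun w => (norm_exp_I_mul_ofReal _).le)
  have hlim : Tendsto (fun P : ℝ => ∫ ξ, fourier₂ G ξ * ∫ c, wavePair x (ξ.1 ^ 2 + ξ.2 ^ 2) c *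
      fourier₁ (fun p => χ (p / P)) (ξ.1 - c)) atTop (𝓝 (∫ ξ, L ξ)) := by
    -- The bound is uniform in `P`, because the `L¹` norm of the transformed cutoff is invariant
    -- under the rescaling.
    refine tendsto_integral_filter_of_dominated_convergence
      (fun ξ => ‖fourier₂ G ξ‖ * (2 * ∫ b, ‖fourier₁ χ b‖)) ?_ ?_ (hGi.norm.mul_const _) ?_
    · filter_upwards [eventually_gt_atTop 0] with P hP
      have hχP := hχ.comp_div hP
      simp_rw [← integral_abs_snd_mul_exp_mul_fourier₁ hχP, ← integral_angleMeasure,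
        ← integral_const_mul]
      refine (integrable_abs_snd_rot_mul_fourier₂ hχP hG hGc x).integral_prod_left.1.congr
        (Eventually.of_forall fun ξ => integral_congr_ae (Eventually.of_forall fun θ => ?_))
      simp only
      ring
    · filter_upwards [eventually_gt_atTop 0] with P hP
      refine Eventually.of_forall fun ξ => ?_
      rw [norm_mul]
      gcongr
      exact hχ.norm_integral_mul_fourier₁_le (norm_wavePair_le x _) _ hP
    · have h0 : ∀ᵐ ξ : ℝ × ℝ, ξ.2 ≠ 0 :=
        Measure.quasiMeasurePreserving_snd.ae (Measure.ae_ne volume 0)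
      filter_upwards [h0] with ξ hξ
      simp only [hL]
      rw [← wavePair_eq x hξ]
      exact (hχ.tendsto_integral_mul_fourier₁ (norm_wavePair_le x _) (measurable_wavePair x _)
        (continuousAt_wavePair x hξ)).const_mul _
  rw [← hval]
  refine (hlim.const_mul _).congr' ?_
  filter_upwards [eventually_gt_atTop 0] with P hP
  rw [invRiesz₂_rotBackProj (hχ.comp_div hP) hG hGc]
  simp_rw [integral_abs_snd_mul_exp_mul_fourier₁ (hχ.comp_div hP)]

/-! ### Smoothness, parity and support of the circular Radon transform. -/

/-- The integral is the value at `0` of a convolution, with parameter `x`, of the indicator of `(0,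
2π]` with a reflected and cut-off `Φ`; convolutions with parameters are smooth. -/
theorem contDiff_integral_angle {E : Type*} [NormedAddCommGroup E] [NormedSpace ℝ E]
    {Φ : E × ℝ → ℂ} (hΦ : ContDiff ℝ ∞ Φ) :
    ContDiff ℝ ∞ fun x => ∫ α in (0 : ℝ)..(2 * Real.pi), Φ (x, α) := by
  -- The inner radius `8` exceeds `2π`, so the bump equals `1` wherever the indicator is nonzero.
  let b : ContDiffBump (0 : ℝ) := ⟨8, 9, by norm_num, by norm_num⟩
  have h := contDiffOn_convolution_right_with_param_comp (n := ⊤) (μ := volume)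
    (ContinuousLinearMap.lsmul ℝ ℝ : ℝ →L[ℝ] ℂ →L[ℝ] ℂ) (s := (Set.univ : Set E))
    (v := fun _ => (0 : ℝ)) contDiffOn_const
    (f := (Set.Ioc (0 : ℝ) (2 * Real.pi)).indicator fun _ => (1 : ℝ))
    (g := fun x y => b y • Φ (x, -y)) (k := Metric.closedBall 0 9) isOpen_univ
    (isCompact_closedBall _ _)
    (fun x y _ hy => by
      have : b y = 0 := b.zero_of_le_dist (not_le.1 hy).le
      simp [this])
    ((integrable_indicator_iff measurableSet_Ioc).2
      (integrableOn_const measure_Ioc_lt_top.ne)).locallyIntegrable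
    (ContDiff.contDiffOn (by
      have h1 : ContDiff ℝ ∞ fun w : E × ℝ => b w.2 := b.contDiff.comp contDiff_snd
      have h2 : ContDiff ℝ ∞ fun w : E × ℝ => Φ (w.1, -w.2) :=
        hΦ.comp (contDiff_fst.prodMk contDiff_snd.neg)
      exact h1.smul h2))
  rw [contDiffOn_univ] at h
  convert h using 2 with x
  rw [intervalIntegral.integral_of_le (by positivity), convolution_def,
    ← integral_indicator measurableSet_Ioc]
  congr 1
  ext t
  by_cases ht : t ∈ Set.Ioc (0 : ℝ) (2 * Real.pi)
  · have hb : b (-t) = 1 := b.one_of_mem_closedBall (by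
      have h8 : t ≤ 8 := ht.2.trans (by linarith [Real.pi_lt_four])
      simpa [abs_of_pos ht.1] using h8)
    simp only [Set.indicator_of_mem ht, ContinuousLinearMap.lsmul_apply, hb, one_smul, zero_sub,
      neg_neg]
  · simp [Set.indicator_of_notMem ht]

theorem contDiff_dir : ContDiff ℝ ∞ dir := by
  rw [contDiff_euclidean]
  intro i
  fin_cases i
  · simpa [dir] using Real.contDiff_cos
  · simpa [dir] using Real.contDiff_sin

theorem norm_dir (α : ℝ) : ‖dir α‖ = 1 := by
  simp [EuclideanSpace.norm_eq, dir]

theorem dir_add_pi (α : ℝ) : dir (α + Real.pi) = -dir α := by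
  ext i
  fin_cases i <;> simp [dir]

theorem dir_add_two_pi (α : ℝ) : dir (α + 2 * Real.pi) = dir α := by
  ext i
  fin_cases i <;> simp [dir]

/-- Changing the sign of the radius amounts to shifting the angle by `π`. -/
theorem circularRadon_neg (f : Plane × ℝ → ℂ) (μ : Plane) (y s : ℝ) :
    circularRadon f μ y (-s) = circularRadon f μ y s := by
  have hp : Function.Periodic (fun α => f (μ + s • dir α, y)) (2 * Real.pi) := fun α => by
    simp only [dir_add_two_pi]
  have h : ∀ α, μ + -s • dir α = μ + s • dir (α + Real.pi) := fun α => by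
    rw [dir_add_pi, neg_smul, smul_neg]
  simp_rw [circularRadon, h]
  rw [intervalIntegral.integral_comp_add_right fun α => f (μ + s • dir α, y)]
  have := hp.intervalIntegral_add_eq Real.pi 0
  rw [zero_add] at this ⊢
  rw [← this, add_comm]

theorem circularRadon_eq_zero {R : ℝ} {f : Plane × ℝ → ℂ}
    (hfs : tsupport f ⊆ Metric.closedBall (0 : Plane) R ×ˢ (Set.univ : Set ℝ)) {μ : Plane}
    (hμ : μ ∈ Metric.sphere (0 : Plane) R) (y : ℝ) {s : ℝ} (hs : 2 * R < |s|) :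
    circularRadon f μ y s = 0 := by
  have h : ∀ α, f (μ + s • dir α, y) = 0 := fun α => by
    by_contra h0
    have h1 := (hfs (subset_tsupport _ h0)).1
    rw [mem_closedBall_zero_iff] at h1
    rw [mem_sphere_zero_iff_norm] at hμ
    have h2 : ‖s • dir α‖ ≤ ‖μ + s • dir α‖ + ‖μ‖ := by
      simpa using norm_sub_le (μ + s • dir α) μ
    rw [norm_smul, norm_dir, mul_one, Real.norm_eq_abs] at h2
    linarith
  simp [circularRadon, h]

/-- The circular Radon transform at `μ`, with radii measured from the radius `u`. -/
def shiftedRadon (u : ℝ) (f : Plane × ℝ → ℂ) (μ : Plane) (x : ℝ × ℝ) : ℂ :=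
  circularRadon f μ x.1 (u + x.2)

theorem contDiff_shiftedRadon (u : ℝ) {f : Plane × ℝ → ℂ} (hf : ContDiff ℝ ∞ f) (μ : Plane) :
    ContDiff ℝ ∞ (shiftedRadon u f μ) := by
  refine contDiff_integral_angle
    (Φ := fun w : (ℝ × ℝ) × ℝ => f (μ + (u + w.1.2) • dir w.2, w.1.1)) (hf.comp ?_)
  have := contDiff_dir
  fun_prop

theorem hasCompactSupport_shiftedRadon (u : ℝ) {R : ℝ} {f : Plane × ℝ → ℂ}
    (hfc : HasCompactSupport f)
    (hfs : tsupport f ⊆ Metric.closedBall (0 : Plane) R ×ˢ (Set.univ : Set ℝ)) {μ : Plane}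
    (hμ : μ ∈ Metric.sphere (0 : Plane) R) : HasCompactSupport (shiftedRadon u f μ) := by
  obtain ⟨A, hA⟩ := hfc.isCompact.isBounded.subset_closedBall 0
  refine HasCompactSupport.intro (isCompact_closedBall (0 : ℝ × ℝ) (max A (2 * R + |u|)))
    fun x hx => ?_
  rw [mem_closedBall_zero_iff, Prod.norm_def, sup_le_iff, not_and_or, not_le, not_le,
    Real.norm_eq_abs, Real.norm_eq_abs] at hx
  rcases hx with hx | hx
  · have h : ∀ α, f (μ + (u + x.2) • dir α, x.1) = 0 := fun α => by
      by_contra h0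
      have h1 := hA (subset_tsupport _ h0)
      rw [mem_closedBall_zero_iff, Prod.norm_def, sup_le_iff, Real.norm_eq_abs] at h1
      exact absurd h1.2 (not_le.2 ((le_max_left _ _).trans_lt hx))
    simp [shiftedRadon, circularRadon, h]
  · refine circularRadon_eq_zero hfs hμ _ ?_
    have h1 := (le_max_right A _).trans_lt hx
    have h2 : |x.2| ≤ |u + x.2| + |u| := by simpa using abs_sub (u + x.2) u
    linarith

/-! ### The toroidal transform as a circular mean. -/

theorem toroidalRadon_eq {f : Plane × ℝ → ℂ} (hf : Continuous f) (u : ℝ) (μ : Plane) (p r : ℝ) :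
    toroidalRadon u f μ p r = (1 / (2 * Real.pi) : ℂ) * ∫ β in (0 : ℝ)..(2 * Real.pi),
      shiftedRadon u f μ (p + r * Real.sin β, -(r * Real.cos β)) := by
  have hd := contDiff_dir.continuous
  have hc : Continuous fun w : ℝ × ℝ =>
      f (μ + (u - r * Real.cos w.2) • dir w.1, p + r * Real.sin w.2) := by fun_prop
  rw [toroidalRadon]
  congr 1
  simp_rw [shiftedRadon, circularRadon, ← integral_angleMeasure, ← sub_eq_add_neg]
  refine integral_integral_swap ?_
  rw [Measure.prod_restrict]
  exact (hc.continuousOn.integrableOn_compact (isCompact_Icc.prod isCompact_Icc)).mono_set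
    (Set.prod_mono Set.Ioc_subset_Icc_self Set.Ioc_subset_Icc_self)

/-- Both sides average over the same circle about `(p, 0)` and differ only in the starting angle,
which periodicity makes irrelevant. -/
theorem toroidalRadon_sqrt {f : Plane × ℝ → ℂ} (hf : Continuous f) (u : ℝ) (μ : Plane) (p : ℝ)
    (x : ℝ × ℝ) : toroidalRadon u f μ p (Real.sqrt ((x.1 - p) ^ 2 + x.2 ^ 2)) =
      rotMean (shiftedRadon u f μ) p x := by
  set r := Real.sqrt ((x.1 - p) ^ 2 + x.2 ^ 2) with hr
  rw [toroidalRadon_eq hf, rotMean]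
  congr 1
  set V : ℝ → ℂ := fun ψ => shiftedRadon u f μ (p + r * Real.cos ψ, r * Real.sin ψ) with hV
  have hVp : Function.Periodic V (2 * Real.pi) := fun ψ => by simp [hV]
  obtain ⟨φ, h1, h2⟩ : ∃ φ, x.1 - p = r * Real.cos φ ∧ x.2 = r * Real.sin φ := by
    have hn : ‖(⟨x.1 - p, x.2⟩ : ℂ)‖ = r := by rw [Complex.norm_eq_sqrt_sq_add_sq]
    refine ⟨Complex.arg ⟨x.1 - p, x.2⟩, ?_, ?_⟩
    · rw [← hn, Complex.norm_mul_cos_arg]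
    · rw [← hn, Complex.norm_mul_sin_arg]
  have e1 : ∀ β, shiftedRadon u f μ (p + r * Real.sin β, -(r * Real.cos β)) =
      V (β - Real.pi / 2) := fun β => by
    simp only [hV, Real.cos_sub_pi_div_two, Real.sin_sub_pi_div_two, mul_neg]
  have e2 : ∀ θ, shiftedRadon u f μ ((p, 0) + rot θ (x - (p, 0))) = V (θ + φ) := fun θ => by
    simp only [hV, Real.cos_add, Real.sin_add]
    congr 1
    ext <;> simp only [rot, Prod.fst_add, Prod.snd_add, Prod.fst_sub, Prod.snd_sub, sub_zero,
      h1, h2] <;> ring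
  simp_rw [e1, e2]
  rw [intervalIntegral.integral_comp_sub_right V, intervalIntegral.integral_comp_add_right V]
  have := hVp.intervalIntegral_add_eq (0 - Real.pi / 2) (0 + φ)
  convert this using 2 <;> ring

theorem localize_toroidalRadon_sqrt {f : Plane × ℝ → ℂ} (hf : Continuous f) (u : ℝ) (μ : Plane)
    (χ : ℝ → ℝ) (P : ℝ) (x : ℝ × ℝ) (p : ℝ) :
    localize χ P (toroidalRadon u f μ) p (Real.sqrt ((x.1 - p) ^ 2 + x.2 ^ 2)) =
      (χ (p / P) : ℂ) * rotMean (shiftedRadon u f μ) p x := by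
  rw [localize, toroidalRadon_sqrt hf]

theorem backProj_localize_toroidalRadon {f : Plane × ℝ → ℂ} (hf : Continuous f) (u : ℝ)
    (μ : Plane) (χ : ℝ → ℝ) (P : ℝ) :
    backProj (localize χ P (toroidalRadon u f μ)) =
      rotBackProj (fun p => χ (p / P)) (shiftedRadon u f μ) := by
  ext x
  simp_rw [backProj, rotBackProj, localize_toroidalRadon_sqrt hf]

theorem isInvRieszBackProj_toroidalRadon {R : ℝ} (u : ℝ) {f : Plane × ℝ → ℂ}
    (hf : ContDiff ℝ ∞ f) (hfc : HasCompactSupport f)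
    (hfs : tsupport f ⊆ Metric.closedBall (0 : Plane) R ×ˢ (Set.univ : Set ℝ)) {μ : Plane}
    (hμ : μ ∈ Metric.sphere (0 : Plane) R) :
    IsInvRieszBackProj (toroidalRadon u f μ) fun z ρ =>
      circularRadon f μ z (u + ρ) + circularRadon f μ z (u - ρ) := by
  intro χ hχ
  have hG := contDiff_shiftedRadon u hf μ
  have hGc := hasCompactSupport_shiftedRadon u hfc hfs hμ
  simp_rw [backProj_localize_toroidalRadon hf.continuous,
    localize_toroidalRadon_sqrt hf.continuous]
  refine ⟨fun P hP => ?_, fun z ρ => ?_⟩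
  · have hχP := hχ.comp_div hP
    exact ⟨integrable_mul_rotMean hχP.1.continuous hχP.2.1 hG.continuous hGc,
      integrable_rotBackProj hχP.1.continuous hχP.2.1 hG.continuous hGc,
      integrable_abs_snd_mul_fourier₂_rotBackProj hχP hG hGc⟩
  · exact tendsto_invRiesz₂_rotBackProj hχ hG hGc z ρ

/-! ### Telescoping and the inversion formula. -/

theorem sum_range_alternating_add_succ (a : ℕ → ℂ) (n : ℕ) :
    ∑ j ∈ Finset.range (n + 1), (-1 : ℂ) ^ j * (a j + a (j + 1)) =
      a 0 + (-1 : ℂ) ^ n * a (n + 1) := by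
  induction n with
  | zero => simp
  | succ n ih =>
    rw [Finset.sum_range_succ, ih]
    ring

end Toroidal

end

theorem mainTheorem4 (R u : ℝ) (hR : 0 < R) (hu : 0 < u)
    (f : Toroidal.Plane × ℝ → ℂ) (hf : ContDiff ℝ ∞ f) (hfc : HasCompactSupport f)
    (hfs : tsupport f ⊆ Metric.closedBall (0 : Toroidal.Plane) R ×ˢ (Set.univ : Set ℝ)) :
    ∃ K : Toroidal.Plane → ℝ → ℝ → ℂ,
      (∀ μ ∈ Metric.sphere (0 : Toroidal.Plane) R,
        Toroidal.IsInvRieszBackProj (Toroidal.toroidalRadon u f μ) (K μ)) ∧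
      ∀ μ ∈ Metric.sphere (0 : Toroidal.Plane) R, ∀ x₃ r : ℝ, 0 < r →
        (r ≤ u → Toroidal.circularRadon f μ x₃ r =
          ∑ j ∈ Finset.range (⌊R / u + 1 / 2⌋₊ + 1),
            (-1 : ℂ) ^ j * K μ x₃ ((2 * j + 1) * u - r)) ∧
        (u < r → Toroidal.circularRadon f μ x₃ r =
          ∑ j ∈ Finset.range (⌊R / u⌋₊ + 1),
            (-1 : ℂ) ^ j * K μ x₃ ((2 * j + 1) * u + r)) := by
  refine ⟨fun μ z ρ => Toroidal.circularRadon f μ z (u + ρ) + Toroidal.circularRadon f μ z (u - ρ),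
    fun μ hμ => Toroidal.isInvRieszBackProj_toroidalRadon u hf hfc hfs hμ,
    fun μ hμ x₃ r hr => ⟨fun hru => ?_, fun _ => ?_⟩⟩
  · have h := Toroidal.sum_range_alternating_add_succ
      (fun j => Toroidal.circularRadon f μ x₃ (2 * j * u - r)) ⌊R / u + 1 / 2⌋₊
    have hz : Toroidal.circularRadon f μ x₃
        (2 * ((⌊R / u + 1 / 2⌋₊ + 1 : ℕ) : ℝ) * u - r) = 0 := by
      refine Toroidal.circularRadon_eq_zero hfs hμ _ (lt_of_lt_of_le ?_ (le_abs_self _))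
      have h1 := Nat.lt_floor_add_one (R / u + 1 / 2)
      -- Since `r ≤ u`, the last radius is at least `(2n + 1)u` with `n` the floor; the summand `1 /
      -- 2` inside the floor makes this exceed `2R`.
      have h2 : R < (⌊R / u + 1 / 2⌋₊ + 1 / 2) * u := by
        rw [← div_lt_iff₀ hu]
        linarith
      push_cast
      linarith
    simp only [hz, mul_zero, add_zero, Nat.cast_zero, zero_mul, zero_sub,
      Toroidal.circularRadon_neg] at h
    rw [← h]
    refine Finset.sum_congr rfl fun j _ => ?_
    beta_reduce
    -- With `ρ = (2j + 1)u - r`, the radius `u + ρ` is that of term `j + 1`, while `u - ρ` is minus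
    -- that of term `j`; evenness removes the sign.
    rw [add_comm (Toroidal.circularRadon _ _ _ _), ← Toroidal.circularRadon_neg f μ x₃ (u - _)]
    congr 3 <;> push_cast <;> ring
  · have h := Toroidal.sum_range_alternating_add_succ
      (fun j => Toroidal.circularRadon f μ x₃ (2 * j * u + r)) ⌊R / u⌋₊
    have hz : Toroidal.circularRadon f μ x₃ (2 * ((⌊R / u⌋₊ + 1 : ℕ) : ℝ) * u + r) = 0 := by
      refine Toroidal.circularRadon_eq_zero hfs hμ _ (lt_of_lt_of_le ?_ (le_abs_self _))
      have h1 := Nat.lt_floor_add_one (R / u)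
      rw [div_lt_iff₀ hu] at h1
      push_cast
      linarith
    simp only [hz, mul_zero, add_zero, Nat.cast_zero, zero_mul, zero_add] at h
    rw [← h]
    refine Finset.sum_congr rfl fun j _ => ?_
    beta_reduce
    rw [add_comm (Toroidal.circularRadon _ _ _ _), ← Toroidal.circularRadon_neg f μ x₃ (u - _)]
    congr 3 <;> push_cast <;> ring
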